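/- There exist absolute constants $c_0,c_1,c_2>0$ for which the following holds. Let $M,N$ be non-negative integers with $N\ge c_0M$, let $x\ge 1$, and let $X$ be the standard Gaussian vector in $\mathbb R^M$. There is a square-integrable, mean-zero, variance-one random variable $\zeta$, independent of $X$ (whose law may depend on $M,N,x$), such that for every $t^*\in\mathbb R^M$ the following is true. Set $Y=\langle X,t^*\rangle+\zeta$, let $R(t)=\mathbb E\,(Y-\langle X,t\rangle)^2$ be the squared risk of $t\in\mathbb R^M$, and let $(X_i,Y_i)_{i=1}^N$ be independent copies of $(X,Y)$. Then $R(t)$ is finite and $\|t-t^*\|_2^2=R(t)-R(t^*)$ for every $t\in\mathbb R^M$, and, with probability at least $c_1/x$, empirical risk minimizers $$\hat t\in\operatorname*{argmin}_{t\in\mathbb R^M}\sum_{i=1}^N\big(Y_i-\langle X_i,t\rangle\big)^2$$ exist and every such $\hat t$ satisfies $$\|\hat t-t^*\|_2^2=R(\hat t)-R(t^*)\ \ge\ \frac{c_2\,x\,M}{N}$$ (for $M=N=0$ the right-hand side is read as $0$). Consequently, an exponential probability bound for empirical risk minimization is impossible when only the second moment of the noise is controlled: for every $M\ge1$, every $t^*\in\mathbb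 R^M$, all constants $C,K,b>0$ and every real sequence $\varepsilon_N\to0$, it is not true that for every $x\ge1$ and all sufficiently large $N$ (depending on $x$), for every mean-zero, variance-one noise $\zeta$ independent of $X$, with probability at least $1-\varepsilon_N-Ke^{-bx}$ some empirical risk minimizer $\hat t$ satisfies $\|\hat t-t^*\|_2^2\le CxM/N$. -/

import Mathlib

open MeasureTheory ProbabilityTheory Filter Topology

namespace GaussianLinearModel

/-- `ν` is the law of a square-integrable real random variable with mean zero and variance one. -/
structure IsStandardizedNoise (ν : Measure ℝ) : Prop where
  isProbabilityMeasure : IsProbabilityMeasure ν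
  memLp_two : MemLp (fun z : ℝ => z) 2 ν
  mean_eq_zero : ∫ z, z ∂ν = 0
  variance_eq_one : Var[fun z : ℝ => z; ν] = 1

/-- The joint law of `(X, Y)` where `Y = ⟨X, tstar⟩ + ζ`, `X` is the standard Gaussian vector of
`ℝ^M`, `ζ` has law `ν`, and `X` and `ζ` are independent (so `(X, ζ)` has the product law). -/
noncomputable def modelLaw {M : ℕ} (tstar : EuclideanSpace ℝ (Fin M)) (ν : Measure ℝ) :
    Measure (EuclideanSpace ℝ (Fin M) × ℝ) :=
  ((stdGaussian (EuclideanSpace ℝ (Fin M))).prod ν).map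
    (fun p => (p.1, inner ℝ p.1 tstar + p.2))

/-- The law of the sample `(X_i, Y_i)`, `i = 1, …, N`, of independent copies of `(X, Y)`. -/
noncomputable def sampleLaw {M : ℕ} (N : ℕ) (tstar : EuclideanSpace ℝ (Fin M)) (ν : Measure ℝ) :
    Measure (Fin N → EuclideanSpace ℝ (Fin M) × ℝ) :=
  Measure.pi (fun _ => modelLaw tstar ν)

/-- The squared loss `(y - ⟨x, t⟩)^2`. -/
noncomputable def loss {M : ℕ} (t : EuclideanSpace ℝ (Fin M))
    (p : EuclideanSpace ℝ (Fin M) × ℝ) : ℝ :=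
  (p.2 - inner ℝ p.1 t) ^ 2

/-- The squared risk `R(t) = E (Y - ⟨X, t⟩)^2`. -/
noncomputable def risk {M : ℕ} (tstar : EuclideanSpace ℝ (Fin M)) (ν : Measure ℝ)
    (t : EuclideanSpace ℝ (Fin M)) : ℝ :=
  ∫ p, loss t p ∂(modelLaw tstar ν)

/-- The set `argmin_t ∑ i, (Y_i - ⟨X_i, t⟩)^2` of empirical risk minimizers for the sample `S`. -/
def ermSet {M N : ℕ} (S : Fin N → EuclideanSpace ℝ (Fin M) × ℝ) :
    Set (EuclideanSpace ℝ (Fin M)) :=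
  {t | ∀ s : EuclideanSpace ℝ (Fin M), ∑ i, loss t (S i) ≤ ∑ i, loss s (S i)}

end GaussianLinearModel

/-! The lower bound comes from a noise that vanishes except for rare spikes: `ζ = ±√(2 x (N + 1))`
with probability `1 / (2 x (N + 1))`. With probability of order `1 / x` exactly one noise variable
`ζ_j` of the sample is nonzero. If `L` denotes the map `v ↦ (⟨X_i, v⟩)_i`, the error
`h = t̂ - tstar` of an empirical risk minimizer then solves the normal equations `L† L h = ζ_j X_j`.
Testing them against `X_j` and against `h` gives `|ζ_j| ‖X_j‖ ^ 3 ≤ ‖h‖ ‖L X_j‖ ^ 2`. A Gaussian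
design satisfies `‖X_j‖ ^ 2 ≈ M` and `‖L X_j‖ ^ 2 ≲ N M` with probability at least `1 / 2`, whence
`‖h‖ ^ 2 ≳ ζ_j ^ 2 M / N ^ 2 ≥ 2 x M / N`. Since failure at the level `x M / N` has probability of
order `1 / x`, no failure probability that is `o(1 / x)` is possible. -/

namespace GaussianLinearModel

section LeastSquares

variable {𝕜 E F : Type*} [RCLike 𝕜] [NormedAddCommGroup E] [InnerProductSpace 𝕜 E]
  [NormedAddCommGroup F] [InnerProductSpace 𝕜 F] {L : E →ₗ[𝕜] F} {y : F} {t : E}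

lemma isMinOn_norm_sub_apply_iff :
    IsMinOn (fun s => ‖y - L s‖) Set.univ t ↔ ∀ v, inner 𝕜 (y - L t) (L v) = 0 := by
  have hbdd : BddBelow (Set.range fun w : LinearMap.range L => ‖y - w‖) :=
    ⟨0, Set.forall_mem_range.2 fun _ => norm_nonneg _⟩
  have hinf : IsMinOn (fun s => ‖y - L s‖) Set.univ t ↔
      ‖y - L t‖ = ⨅ w : LinearMap.range L, ‖y - w‖ := by
    rw [isMinOn_univ_iff]
    refine ⟨fun h => le_antisymm (le_ciInf ?_) (ciInf_le hbdd ⟨L t, L.mem_range_self t⟩),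
      fun h s => h.trans_le (ciInf_le hbdd ⟨L s, L.mem_range_self s⟩)⟩
    rintro ⟨_, s, rfl⟩
    exact h s
  rw [hinf, Submodule.norm_eq_iInf_iff_inner_eq_zero _ (L.mem_range_self t)]
  exact Set.forall_mem_range

lemma exists_isMinOn_norm_sub_apply (L : E →ₗ[𝕜] F) [(LinearMap.range L).HasOrthogonalProjection]
    (y : F) : ∃ t, IsMinOn (fun s => ‖y - L s‖) Set.univ t := by
  obtain ⟨t, ht⟩ := (LinearMap.range L).starProjection_apply_mem y
  refine ⟨t, isMinOn_norm_sub_apply_iff.2 fun v => ?_⟩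
  rw [ht]
  exact Submodule.starProjection_inner_eq_zero y _ (L.mem_range_self v)

/-- The hypothesis on `w` says `w = L† y`. Testing the normal equations `L† L t = w` against `w`
and against `t` gives `‖w‖ ^ 2 ≤ ‖L t‖ * ‖L w‖` and `‖L t‖ ^ 2 ≤ ‖w‖ * ‖t‖`. -/
lemma norm_pow_three_le_of_isMinOn (ht : IsMinOn (fun s => ‖y - L s‖) Set.univ t) {w : E}
    (hw : ∀ v, inner 𝕜 y (L v) = inner 𝕜 w v) : ‖w‖ ^ 3 ≤ ‖t‖ * ‖L w‖ ^ 2 := by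
  have normal (v : E) : inner 𝕜 w v = inner 𝕜 (L t) (L v) := by
    rw [← hw, ← sub_eq_zero, ← inner_sub_left, isMinOn_norm_sub_apply_iff.1 ht]
  have test_w : ‖w‖ ^ 2 ≤ ‖L t‖ * ‖L w‖ :=
    calc ‖w‖ ^ 2 = ‖inner 𝕜 w w‖ := by simp [inner_self_eq_norm_sq_to_K]
      _ = ‖inner 𝕜 (L t) (L w)‖ := by rw [normal]
      _ ≤ ‖L t‖ * ‖L w‖ := norm_inner_le_norm _ _
  have test_t : ‖L t‖ ^ 2 ≤ ‖w‖ * ‖t‖ :=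
    calc ‖L t‖ ^ 2 = ‖inner 𝕜 (L t) (L t)‖ := by simp [inner_self_eq_norm_sq_to_K]
      _ = ‖inner 𝕜 w t‖ := by rw [normal]
      _ ≤ ‖w‖ * ‖t‖ := norm_inner_le_norm _ _
  rcases (norm_nonneg w).eq_or_lt with hw₀ | hw₀
  · rw [← hw₀, zero_pow three_ne_zero]
    positivity
  refine le_of_mul_le_mul_left ?_ hw₀
  calc ‖w‖ * ‖w‖ ^ 3 = (‖w‖ ^ 2) ^ 2 := by ring
    _ ≤ (‖L t‖ * ‖L w‖) ^ 2 := by gcongr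
    _ = ‖L t‖ ^ 2 * ‖L w‖ ^ 2 := by ring
    _ ≤ ‖w‖ * ‖t‖ * ‖L w‖ ^ 2 := by gcongr
    _ = ‖w‖ * (‖t‖ * ‖L w‖ ^ 2) := by ring

end LeastSquares

section DesignMap

variable {ι E : Type*} [NormedAddCommGroup E] [InnerProductSpace ℝ E]

/-- The linear map `v ↦ (⟪x i, v⟫)ᵢ` of a design `x`, with values in a Euclidean space so that the
empirical squared loss is a squared norm. -/
noncomputable def designMap (x : ι → E) : E →ₗ[ℝ] EuclideanSpace ℝ ι :=
  (WithLp.linearEquiv 2 ℝ (ι → ℝ)).symm ∘ₗ LinearMap.pi fun i => innerₛₗ ℝ (x i)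

@[simp]
lemma designMap_apply (x : ι → E) (v : E) (i : ι) : designMap x v i = inner ℝ (x i) v := rfl

variable [Fintype ι]

lemma abs_mul_norm_pow_three_le_of_isMinOn {x : ι → E} {ξ : ι → ℝ} {j : ι}
    (hξ : ∀ i ≠ j, ξ i = 0) {h : E}
    (hh : IsMinOn (fun v => ‖WithLp.toLp 2 ξ - designMap x v‖) Set.univ h) :
    |ξ j| * ‖x j‖ ^ 3 ≤ ‖h‖ * ∑ i, inner ℝ (x i) (x j) ^ 2 := by
  have hw (v : E) : inner ℝ (WithLp.toLp 2 ξ) (designMap x v) = inner ℝ (ξ j • x j) v := by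
    rw [PiLp.inner_apply, Finset.sum_eq_single j (fun i _ hi => by simp [hξ i hi]) (by simp),
      real_inner_smul_left, designMap_apply]
    simp [mul_comm]
  have hcube := norm_pow_three_le_of_isMinOn hh hw
  rw [map_smul, norm_smul, norm_smul, Real.norm_eq_abs, mul_pow _ ‖designMap x (x j)‖,
    EuclideanSpace.real_norm_sq_eq] at hcube
  simp only [designMap_apply] at hcube
  rcases (abs_nonneg (ξ j)).eq_or_lt with hz | hz
  · rw [← hz, zero_mul]
    exact mul_nonneg (norm_nonneg h) (Finset.sum_nonneg fun i _ => sq_nonneg _)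
  · refine le_of_mul_le_mul_left ?_ (pow_pos hz 2)
    linarith

end DesignMap

section EmpiricalRisk

variable {M N : ℕ}

/-- The residuals `Y_i - ⟨X_i, t⟩` of the parameter `t` on the sample `S`; for `t = tstar` they are
the noise variables `ζ_i`. -/
noncomputable def residual (t : EuclideanSpace ℝ (Fin M))
    (S : Fin N → EuclideanSpace ℝ (Fin M) × ℝ) (i : Fin N) : ℝ :=
  (S i).2 - inner ℝ (S i).1 t

lemma mem_ermSet_iff_isMinOn (t₀ : EuclideanSpace ℝ (Fin M))
    {S : Fin N → EuclideanSpace ℝ (Fin M) × ℝ} {t : EuclideanSpace ℝ (Fin M)} :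
    t ∈ ermSet S ↔ IsMinOn (fun h => ‖WithLp.toLp 2 (residual t₀ S) -
      designMap (fun i => (S i).1) h‖) Set.univ (t - t₀) := by
  have hloss (s : EuclideanSpace ℝ (Fin M)) : ∑ i, loss s (S i) =
      ‖WithLp.toLp 2 (residual t₀ S) - designMap (fun i => (S i).1) (s - t₀)‖ ^ 2 := by
    rw [EuclideanSpace.real_norm_sq_eq]
    refine Finset.sum_congr rfl fun i _ => ?_
    simp only [PiLp.sub_apply, designMap_apply, residual, loss, inner_sub_right]
    ring
  rw [isMinOn_univ_iff, ← (Equiv.subRight t₀).forall_congr_right]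
  simp only [ermSet, Set.mem_ofPred_eq, hloss, Equiv.subRight_apply,
    pow_le_pow_iff_left₀ (norm_nonneg _) (norm_nonneg _) two_ne_zero]

lemma ermSet_nonempty (S : Fin N → EuclideanSpace ℝ (Fin M) × ℝ) : (ermSet S).Nonempty := by
  obtain ⟨t, ht⟩ := exists_isMinOn_norm_sub_apply (designMap fun i => (S i).1)
    (WithLp.toLp 2 (residual 0 S))
  exact ⟨t, (mem_ermSet_iff_isMinOn 0).2 (by rwa [sub_zero])⟩

end EmpiricalRisk

section Probability

variable {Ω : Type*} [MeasurableSpace Ω] {μ : Measure Ω}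

lemma measureReal_mul_le_le_one_div {f : Ω → ℝ} (hf₀ : 0 ≤ᵐ[μ] f) (hf : Integrable f μ) {a c : ℝ}
    (ha : 0 < a) (hc : 0 < c) (hfa : ∫ ω, f ω ∂μ ≤ a) : μ.real {ω | c * a ≤ f ω} ≤ 1 / c := by
  have hmarkov := (mul_meas_ge_le_integral_of_nonneg hf₀ hf (c * a)).trans hfa
  rw [le_div_iff₀ hc]
  exact le_of_mul_le_mul_left (by linarith) ha

/-- On the event, at least half of the `f i` are below `a`, an event to which Markov's inequality
applies. -/
lemma measureReal_sum_lt_le {ι : Type*} [Fintype ι] [Nonempty ι] [IsFiniteMeasure μ]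
    {f : ι → Ω → ℝ} (hf₀ : ∀ i ω, 0 ≤ f i ω) (hf : ∀ i, Measurable (f i)) {a q : ℝ} (ha : 0 < a)
    (hq : 0 < q) (hsmall : ∀ i, μ.real {ω | f i ω < a} ≤ q) :
    μ.real {ω | ∑ i, f i ω < Fintype.card ι * a / 2} ≤ 2 * q := by
  let s (i : ι) : Set Ω := {ω | f i ω < a}
  have hs (i : ι) : MeasurableSet (s i) := measurableSet_lt (hf i) measurable_const
  have hint (i : ι) : Integrable ((s i).indicator (1 : Ω → ℝ)) μ :=
    (integrable_const (1 : ℝ)).indicator (hs i)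
  have hmean : ∫ ω, ∑ i, (s i).indicator (1 : Ω → ℝ) ω ∂μ ≤ Fintype.card ι * q := by
    rw [integral_finsetSum _ fun i _ => hint i]
    simp_rw [integral_indicator_one (hs _)]
    exact (Finset.sum_le_card_nsmul _ _ q fun i _ => hsmall i).trans_eq (by simp)
  have hmarkov := measureReal_mul_le_le_one_div (c := 1 / (2 * q))
    (ae_of_all μ fun ω => Finset.sum_nonneg fun i _ => Set.indicator_nonneg (by simp) ω)
    (integrable_finsetSum _ fun i _ => hint i) (by positivity) (by positivity) hmean
  rw [one_div_one_div] at hmarkov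
  refine (measureReal_mono fun ω (hω : ∑ i, f i ω < _) => ?_).trans hmarkov
  have hterm (i : ι) : a * (1 - (s i).indicator (1 : Ω → ℝ) ω) ≤ f i ω := by
    by_cases hi : ω ∈ s i
    · simpa [hi] using hf₀ i ω
    · simpa [hi] using not_lt.1 hi
  have hsum := (Finset.sum_le_sum fun i _ => hterm i).trans_lt hω
  rw [← Finset.mul_sum, Finset.sum_sub_distrib, Finset.sum_const, Finset.card_univ, nsmul_one,
    mul_comm _ a, mul_div_assoc] at hsum
  have hhalf : 1 / (2 * q) * (Fintype.card ι * q) = (Fintype.card ι : ℝ) / 2 := by field_simp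
  rw [Set.mem_ofPred_eq, hhalf]
  linarith [lt_of_mul_lt_mul_left hsum ha.le]

lemma measurePreserving_eval_pair {ι : Type*} [Fintype ι] [IsProbabilityMeasure μ] {i j : ι}
    (hij : i ≠ j) :
    MeasurePreserving (fun X : ι → Ω => (X i, X j)) (Measure.pi fun _ => μ) (μ.prod μ) := by
  refine ⟨by fun_prop, ?_⟩
  have hindep : IndepFun (fun X : ι → Ω => X i) (fun X => X j) (Measure.pi fun _ => μ) :=
    (iIndepFun_pi (X := fun _ => id) fun _ => aemeasurable_id).indepFun hij
  rw [(indepFun_iff_map_prod_eq_prod_map_map (measurable_pi_apply i).aemeasurable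
    (measurable_pi_apply j).aemeasurable).1 hindep]
  congr 1
  · exact (measurePreserving_eval (fun _ : ι => μ) i).map_eq
  · exact (measurePreserving_eval (fun _ : ι => μ) j).map_eq

end Probability

section Gaussian

lemma gaussianReal_real_le (m : ℝ) {v : NNReal} (hv : v ≠ 0) {s : Set ℝ} (hs : volume s < ⊤) :
    (gaussianReal m v).real s ≤ (√(2 * Real.pi * v))⁻¹ * volume.real s := by
  have hpdf (x : ℝ) : gaussianPDFReal m v x ≤ (√(2 * Real.pi * v))⁻¹ :=
    mul_le_of_le_one_right (by positivity)
      (Real.exp_le_one_iff.2 (div_nonpos_of_nonpos_of_nonneg (by simp [sq_nonneg]) (by positivity)))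
  rw [measureReal_def, gaussianReal_apply_eq_integral m hv,
    ENNReal.toReal_ofReal (integral_nonneg fun x => gaussianPDFReal_nonneg m v x)]
  refine (Real.le_norm_self _).trans (norm_setIntegral_le_of_norm_le_const hs fun x _ => ?_)
  rw [Real.norm_of_nonneg (gaussianPDFReal_nonneg m v x)]
  exact hpdf x

lemma gaussianReal_real_sq_lt_le :
    (gaussianReal 0 1).real {x | x ^ 2 < 1 / 64} ≤ 1 / 8 := by
  have hset : {x : ℝ | x ^ 2 < 1 / 64} = Set.Ioo (-(1 / 8)) (1 / 8) := by
    ext x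
    rw [Set.mem_ofPred_eq, Set.mem_Ioo, ← abs_lt, show (1 / 64 : ℝ) = (1 / 8) ^ 2 by norm_num,
      sq_lt_sq, abs_of_pos (show (0 : ℝ) < 1 / 8 by norm_num)]
  have hsqrt : (2 : ℝ) ≤ √(2 * Real.pi * (1 : NNReal)) :=
    Real.le_sqrt_of_sq_le (by rw [NNReal.coe_one]; linarith [Real.pi_gt_three])
  rw [hset]
  calc (gaussianReal 0 1).real (Set.Ioo (-(1 / 8)) (1 / 8))
      ≤ (√(2 * Real.pi * (1 : NNReal)))⁻¹ * volume.real (Set.Ioo (-(1 / 8) : ℝ) (1 / 8)) :=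
        gaussianReal_real_le 0 one_ne_zero (by simp)
    _ ≤ 2⁻¹ * volume.real (Set.Ioo (-(1 / 8) : ℝ) (1 / 8)) := by gcongr
    _ = 1 / 8 := by rw [Real.volume_real_Ioo_of_le] <;> norm_num

variable {E : Type*} [NormedAddCommGroup E] [InnerProductSpace ℝ E] [FiniteDimensional ℝ E]
  [MeasurableSpace E] [BorelSpace E]

lemma measurePreserving_inner_stdGaussian (v : E) :
    MeasurePreserving (fun x => inner ℝ x v) (stdGaussian E) (gaussianReal 0 (‖v‖₊ ^ 2)) := by
  refine ⟨by fun_prop, ?_⟩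
  have h := IsGaussian.map_eq_gaussianReal (μ := stdGaussian E) (innerSL ℝ v)
  rw [integral_strongDual_stdGaussian, variance_dual_stdGaussian, innerSL_apply_norm] at h
  convert h using 2
  · ext x
    rw [innerSL_apply_apply, real_inner_comm]
  · rw [← NNReal.coe_inj, Real.coe_toNNReal _ (sq_nonneg _), NNReal.coe_pow, coe_nnnorm]

lemma memLp_inner_stdGaussian (v : E) : MemLp (fun x => inner ℝ x v) 2 (stdGaussian E) :=
  IsGaussian.memLp_two_id.inner_const v

lemma integral_inner_stdGaussian (v : E) : ∫ x, inner ℝ x v ∂stdGaussian E = 0 := by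
  simpa using (measurePreserving_inner_stdGaussian v).hasLaw.integral_eq

lemma variance_inner_stdGaussian (v : E) : Var[fun x => inner ℝ x v; stdGaussian E] = ‖v‖ ^ 2 := by
  rw [(measurePreserving_inner_stdGaussian v).hasLaw.variance_eq, variance_id_gaussianReal,
    NNReal.coe_pow, coe_nnnorm]

lemma integral_inner_sq_stdGaussian (v : E) : ∫ x, inner ℝ x v ^ 2 ∂stdGaussian E = ‖v‖ ^ 2 := by
  rw [← variance_inner_stdGaussian, variance_of_integral_eq_zero (by fun_prop)
    (integral_inner_stdGaussian v)]

lemma integrable_norm_sq_stdGaussian : Integrable (fun x => ‖x‖ ^ 2) (stdGaussian E) :=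
  IsGaussian.memLp_two_id.integrable_norm_pow two_ne_zero

lemma integral_norm_sq_stdGaussian : ∫ x, ‖x‖ ^ 2 ∂stdGaussian E = Module.finrank ℝ E := by
  simp_rw [← (stdOrthonormalBasis ℝ E).sum_sq_inner_left]
  rw [integral_finsetSum _ fun i _ => (memLp_inner_stdGaussian _).integrable_sq]
  simp [integral_inner_sq_stdGaussian]

lemma integrable_inner_sq_prod_stdGaussian :
    Integrable (fun p : E × E => inner ℝ p.1 p.2 ^ 2) ((stdGaussian E).prod (stdGaussian E)) := by
  refine (integrable_norm_sq_stdGaussian.mul_prod integrable_norm_sq_stdGaussian).mono'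
    (by fun_prop) (ae_of_all _ fun p => ?_)
  rw [Real.norm_of_nonneg (sq_nonneg _), ← mul_pow]
  exact sq_le_sq' (neg_le_of_abs_le (abs_real_inner_le_norm _ _)) (real_inner_le_norm _ _)

lemma integral_inner_sq_prod_stdGaussian :
    ∫ p : E × E, inner ℝ p.1 p.2 ^ 2 ∂(stdGaussian E).prod (stdGaussian E) =
      Module.finrank ℝ E := by
  rw [integral_prod _ integrable_inner_sq_prod_stdGaussian, ← integral_norm_sq_stdGaussian]
  simp_rw [← integral_inner_sq_stdGaussian, real_inner_comm]

lemma stdGaussian_real_norm_sq_lt_le [Nontrivial E] :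
    (stdGaussian E).real {x | ‖x‖ ^ 2 < Module.finrank ℝ E / 128} ≤ 1 / 4 := by
  have : Nonempty (Fin (Module.finrank ℝ E)) := Fin.pos_iff_nonempty.1 Module.finrank_pos
  let b := stdOrthonormalBasis ℝ E
  have hcoord (i : Fin (Module.finrank ℝ E)) :
      (stdGaussian E).real {x | inner ℝ x (b i) ^ 2 < 1 / 64} ≤ 1 / 8 := by
    have hlaw := measurePreserving_inner_stdGaussian (b i)
    rw [b.nnnorm_eq_one, one_pow] at hlaw
    exact (hlaw.measureReal_preimage
      (measurableSet_lt (by fun_prop) measurable_const).nullMeasurableSet).trans_le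
      gaussianReal_real_sq_lt_le
  have hsum := measureReal_sum_lt_le (μ := stdGaussian E) (f := fun i x => inner ℝ x (b i) ^ 2)
    (fun _ _ => sq_nonneg _) (fun _ => by fun_prop) (by norm_num) (by norm_num) hcoord
  simp only [b.sum_sq_inner_left, Fintype.card_fin] at hsum
  rw [show (Module.finrank ℝ E : ℝ) / 128 = Module.finrank ℝ E * (1 / 64) / 2 by ring]
  exact hsum.trans_eq (by norm_num)

end Gaussian

section TypicalDesign

variable {ι E : Type*} [Fintype ι] [NormedAddCommGroup E] [InnerProductSpace ℝ E]

section Moments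

variable [FiniteDimensional ℝ E] [MeasurableSpace E] [BorelSpace E] [Nontrivial E]

lemma stdGaussian_pi_real_norm_sq_ge_le (j : ι) :
    (Measure.pi fun _ : ι => stdGaussian E).real {X | 8 * Module.finrank ℝ E ≤ ‖X j‖ ^ 2} ≤
      1 / 8 := by
  refine measureReal_mul_le_le_one_div (ae_of_all _ fun _ => sq_nonneg _)
    (integrable_comp_eval (μ := fun _ : ι => stdGaussian E) (i := j)
      (f := fun x : E => ‖x‖ ^ 2) integrable_norm_sq_stdGaussian)
    (Nat.cast_pos.2 Module.finrank_pos) (by norm_num) ?_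
  rw [integral_comp_eval (μ := fun _ : ι => stdGaussian E) (f := fun x : E => ‖x‖ ^ 2)
    (by fun_prop), integral_norm_sq_stdGaussian]

variable [DecidableEq ι]

lemma stdGaussian_pi_real_sum_inner_sq_ge_le (j : ι) :
    (Measure.pi fun _ : ι => stdGaussian E).real {X | 8 * (Fintype.card ι * Module.finrank ℝ E) ≤
      ∑ i ∈ Finset.univ.erase j, inner ℝ (X i) (X j) ^ 2} ≤ 1 / 8 := by
  have : Nonempty ι := ⟨j⟩
  have hfinrank : 0 < Module.finrank ℝ E := Module.finrank_pos
  have hpair {i : ι} (hi : i ∈ Finset.univ.erase j) :=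
    measurePreserving_eval_pair (μ := stdGaussian E) (Finset.ne_of_mem_erase hi)
  have hint : ∀ i ∈ Finset.univ.erase j, Integrable (fun X : ι → E => inner ℝ (X i) (X j) ^ 2)
      (Measure.pi fun _ => stdGaussian E) := fun i hi =>
    (hpair hi).integrable_comp_of_integrable integrable_inner_sq_prod_stdGaussian
  have hmean : ∀ i ∈ Finset.univ.erase j, ∫ X : ι → E, inner ℝ (X i) (X j) ^ 2
      ∂Measure.pi (fun _ => stdGaussian E) = Module.finrank ℝ E := fun i hi =>
    ((hpair hi).hasLaw.integral_comp (f := fun p : E × E => inner ℝ p.1 p.2 ^ 2)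
      (by fun_prop)).trans integral_inner_sq_prod_stdGaussian
  refine measureReal_mul_le_le_one_div (ae_of_all _ fun _ => Finset.sum_nonneg fun _ _ =>
    sq_nonneg _) (integrable_finsetSum _ hint) (by positivity) (by norm_num) ?_
  rw [integral_finsetSum _ hint, Finset.sum_congr rfl hmean, Finset.sum_const, nsmul_eq_mul]
  gcongr
  exact Finset.card_le_univ _

end Moments

variable [DecidableEq ι]

/-- The designs whose `j`-th vector has a norm typical for a standard Gaussian vector of `E` and
typical correlations with the other vectors. The constants are those for which Markov's inequality
gives this event probability at least `1 / 2`. -/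
def typicalDesign (E : Type*) [NormedAddCommGroup E] [InnerProductSpace ℝ E] (j : ι) :
    Set (ι → E) :=
  {X | (Module.finrank ℝ E : ℝ) / 128 ≤ ‖X j‖ ^ 2 ∧ ‖X j‖ ^ 2 ≤ 8 * Module.finrank ℝ E ∧
    ∑ i ∈ Finset.univ.erase j, inner ℝ (X i) (X j) ^ 2 ≤
      8 * (Fintype.card ι * Module.finrank ℝ E)}

lemma sum_inner_sq_le_of_mem_typicalDesign {X : ι → E} {j : ι} (hX : X ∈ typicalDesign E j)
    (hdim : Module.finrank ℝ E ≤ Fintype.card ι) :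
    ∑ i, inner ℝ (X i) (X j) ^ 2 ≤ 72 * (Fintype.card ι * Module.finrank ℝ E) := by
  obtain ⟨-, hnorm, hcorr⟩ := hX
  have hself : (‖X j‖ ^ 2) ^ 2 ≤ 64 * (Fintype.card ι * Module.finrank ℝ E) :=
    calc (‖X j‖ ^ 2) ^ 2 ≤ (8 * (Module.finrank ℝ E : ℝ)) ^ 2 := by gcongr
      _ = 64 * ((Module.finrank ℝ E : ℝ) * Module.finrank ℝ E) := by ring
      _ ≤ 64 * (Fintype.card ι * Module.finrank ℝ E) := by gcongr
  rw [← Finset.add_sum_erase _ _ (Finset.mem_univ j), real_inner_self_eq_norm_sq]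
  linarith

lemma sq_mul_finrank_div_le_of_isMinOn {X : ι → E} {j : ι} (hX : X ∈ typicalDesign E j)
    (hdim : Module.finrank ℝ E ≤ Fintype.card ι) {ξ : ι → ℝ} (hξ : ∀ i ≠ j, ξ i = 0) {h : E}
    (hh : IsMinOn (fun v => ‖WithLp.toLp 2 ξ - designMap X v‖) Set.univ h) :
    ξ j ^ 2 * (Module.finrank ℝ E / (128 ^ 3 * 72 ^ 2 * Fintype.card ι ^ 2)) ≤ ‖h‖ ^ 2 := by
  set d : ℝ := (Module.finrank ℝ E : ℝ)
  set n : ℝ := (Fintype.card ι : ℝ)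
  rcases (show 0 ≤ d from Nat.cast_nonneg _).eq_or_lt with (hd₀ : 0 = d) | hd₀
  · rw [← hd₀, zero_div, mul_zero]
    exact sq_nonneg _
  have hn₀ : 0 < n := hd₀.trans_le (Nat.cast_le.2 hdim)
  have hmain : ξ j ^ 2 * (d / 128) ^ 3 ≤ ‖h‖ ^ 2 * (72 * (n * d)) ^ 2 :=
    calc ξ j ^ 2 * (d / 128) ^ 3 ≤ ξ j ^ 2 * (‖X j‖ ^ 2) ^ 3 := by gcongr; exact hX.1
      _ = (|ξ j| * ‖X j‖ ^ 3) ^ 2 := by rw [mul_pow, sq_abs]; ring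
      _ ≤ (‖h‖ * ∑ i, inner ℝ (X i) (X j) ^ 2) ^ 2 :=
        pow_le_pow_left₀ (by positivity) (abs_mul_norm_pow_three_le_of_isMinOn hξ hh) 2
      _ ≤ (‖h‖ * (72 * (n * d))) ^ 2 := by
        gcongr
        exact sum_inner_sq_le_of_mem_typicalDesign hX hdim
      _ = ‖h‖ ^ 2 * (72 * (n * d)) ^ 2 := mul_pow _ _ _
  refine le_of_mul_le_mul_right (hmain.trans_eq' ?_) (show 0 < (72 * (n * d)) ^ 2 by positivity)
  field_simp

variable [MeasurableSpace E] [BorelSpace E] [FiniteDimensional ℝ E]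

lemma measurableSet_typicalDesign (j : ι) : MeasurableSet (typicalDesign E j) := by
  unfold typicalDesign
  measurability

variable [Nontrivial E]

lemma half_le_stdGaussian_pi_real_typicalDesign (j : ι) :
    1 / 2 ≤ (Measure.pi fun _ : ι => stdGaussian E).real (typicalDesign E j) := by
  set P := Measure.pi fun _ : ι => stdGaussian E
  let short : Set (ι → E) := {X | ‖X j‖ ^ 2 < Module.finrank ℝ E / 128}
  let long : Set (ι → E) := {X | 8 * Module.finrank ℝ E ≤ ‖X j‖ ^ 2}
  let correlated : Set (ι → E) := {X | 8 * (Fintype.card ι * Module.finrank ℝ E) ≤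
    ∑ i ∈ Finset.univ.erase j, inner ℝ (X i) (X j) ^ 2}
  have hshort : P.real short ≤ 1 / 4 :=
    ((measurePreserving_eval (fun _ : ι => stdGaussian E) j).measureReal_preimage
      (measurableSet_lt (by fun_prop) measurable_const).nullMeasurableSet).trans_le
      stdGaussian_real_norm_sq_lt_le
  have hcover : (typicalDesign E j)ᶜ ⊆ short ∪ long ∪ correlated := by
    intro X hX
    by_contra! hcon
    simp only [short, long, correlated, Set.mem_union, Set.mem_ofPred_eq, not_or, not_lt,
      not_le] at hcon
    exact hX ⟨hcon.1.1, hcon.1.2.le, hcon.2.le⟩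
  have hcompl : P.real (typicalDesign E j)ᶜ ≤ 1 / 4 + 1 / 8 + 1 / 8 :=
    calc P.real (typicalDesign E j)ᶜ ≤ P.real (short ∪ long ∪ correlated) := measureReal_mono hcover
      _ ≤ P.real short + P.real long + P.real correlated :=
        (measureReal_union_le _ _).trans (add_le_add_left (measureReal_union_le _ _) _)
      _ ≤ 1 / 4 + 1 / 8 + 1 / 8 := add_le_add (add_le_add hshort
        (stdGaussian_pi_real_norm_sq_ge_le j)) (stdGaussian_pi_real_sum_inner_sq_ge_le j)
  rw [probReal_compl_eq_one_sub (measurableSet_typicalDesign j)] at hcompl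
  linarith

end TypicalDesign

section SparseNoise

/-- The law of the noise equal to `±1 / √p` with probability `p / 2` each, and to `0` otherwise. -/
noncomputable def sparseNoise (p : ℝ) : Measure ℝ :=
  ENNReal.ofReal (1 - p) • Measure.dirac 0 +
    ENNReal.ofReal (p / 2) • (Measure.dirac (√p)⁻¹ + Measure.dirac (-(√p)⁻¹))

lemma integrable_sparseNoise (p : ℝ) (f : ℝ → ℝ) : Integrable f (sparseNoise p) := by
  have hdirac (a : ℝ) : Integrable f (Measure.dirac a) := integrable_dirac (by simp)
  exact ((hdirac _).smul_measure (by simp)).add_measure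
    (((hdirac _).add_measure (hdirac _)).smul_measure (by simp))

variable {p : ℝ}

lemma integral_sparseNoise (hp₀ : 0 ≤ p) (hp₁ : p ≤ 1) (f : ℝ → ℝ) :
    ∫ z, f z ∂sparseNoise p = (1 - p) * f 0 + p / 2 * (f (√p)⁻¹ + f (-(√p)⁻¹)) := by
  have hdirac (a : ℝ) : Integrable f (Measure.dirac a) := integrable_dirac (by simp)
  rw [sparseNoise, integral_add_measure ((hdirac _).smul_measure (by simp))
    (((hdirac _).add_measure (hdirac _)).smul_measure (by simp)), integral_smul_measure,
    integral_smul_measure, integral_add_measure (hdirac _) (hdirac _)]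
  simp [hp₁, div_nonneg hp₀ zero_le_two]

lemma isProbabilityMeasure_sparseNoise (hp₀ : 0 ≤ p) (hp₁ : p ≤ 1) :
    IsProbabilityMeasure (sparseNoise p) := by
  rw [isProbabilityMeasure_iff_real]
  have htotal := integral_sparseNoise hp₀ hp₁ fun _ => 1
  rw [integral_const, smul_eq_mul, mul_one] at htotal
  linarith

lemma sparseNoise_real {s : Set ℝ} (hp₀ : 0 ≤ p) (hp₁ : p ≤ 1) (hs : MeasurableSet s)
    (hzero : (0 : ℝ) ∉ s) (hpos : (√p)⁻¹ ∈ s) (hneg : -(√p)⁻¹ ∈ s) :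
    (sparseNoise p).real s = p := by
  rw [← integral_indicator_one hs, integral_sparseNoise hp₀ hp₁, Set.indicator_of_notMem hzero,
    Set.indicator_of_mem hpos, Set.indicator_of_mem hneg, Pi.one_apply, Pi.one_apply]
  ring

lemma sparseNoise_real_compl_zero (hp₀ : 0 < p) (hp₁ : p ≤ 1) :
    (sparseNoise p).real {0}ᶜ = p := by
  have hsqrt : (√p)⁻¹ ≠ 0 := (inv_pos.2 (Real.sqrt_pos.2 hp₀)).ne'
  exact sparseNoise_real hp₀.le hp₁ (measurableSet_singleton 0).compl (by simp) hsqrt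
    (neg_ne_zero.2 hsqrt)

lemma sparseNoise_real_inv_le_sq (hp₀ : 0 < p) (hp₁ : p ≤ 1) :
    (sparseNoise p).real {z | p⁻¹ ≤ z ^ 2} = p := by
  have hsq : p⁻¹ ≤ (√p)⁻¹ ^ 2 := by rw [inv_pow, Real.sq_sqrt hp₀.le]
  refine sparseNoise_real hp₀.le hp₁ (measurableSet_le (by fun_prop) (by fun_prop)) ?_ hsq
    (hsq.trans_eq (neg_sq _).symm)
  simpa using hp₀

lemma isStandardizedNoise_sparseNoise (hp₀ : 0 < p) (hp₁ : p ≤ 1) :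
    IsStandardizedNoise (sparseNoise p) := by
  have hmean : ∫ z, z ∂sparseNoise p = 0 := by
    rw [integral_sparseNoise hp₀.le hp₁ fun z => z]
    simp
  refine ⟨isProbabilityMeasure_sparseNoise hp₀.le hp₁,
    (memLp_two_iff_integrable_sq (by fun_prop)).2 (integrable_sparseNoise p _), hmean, ?_⟩
  rw [variance_of_integral_eq_zero (by fun_prop) hmean,
    integral_sparseNoise hp₀.le hp₁ fun z => z ^ 2, neg_sq, inv_pow, Real.sq_sqrt hp₀.le]
  field_simp
  ring

end SparseNoise

section IsolatedNoise

variable {ι : Type*} {A : Set ℝ} {j : ι}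

/-- The noise vectors whose `j`-th entry lies in `A` and whose other entries vanish. -/
def isolatedNoise (j : ι) (A : Set ℝ) : Set (ι → ℝ) :=
  {ξ | ξ j ∈ A ∧ ∀ i ≠ j, ξ i = 0}

lemma disjoint_isolatedNoise (hA : (0 : ℝ) ∉ A) {k : ι} (hjk : j ≠ k) :
    Disjoint (isolatedNoise j A) (isolatedNoise k A) :=
  Set.disjoint_left.2 fun _ hj hk => hA (hk.2 j hjk ▸ hj.1)

lemma isolatedNoise_eq_pi [DecidableEq ι] :
    isolatedNoise j A = Set.univ.pi (Function.update (fun _ => {0}) j A) := by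
  ext ξ
  rw [Set.mem_univ_pi, Function.forall_update_iff _ fun i s => ξ i ∈ s]
  rfl

lemma measurableSet_isolatedNoise [Countable ι] (hA : MeasurableSet A) :
    MeasurableSet (isolatedNoise j A) := by
  classical
  rw [isolatedNoise_eq_pi]
  exact MeasurableSet.univ_pi <| (Function.forall_update_iff _ fun _ s => MeasurableSet s).2
    ⟨hA, fun _ _ => measurableSet_singleton 0⟩

variable [Fintype ι] {ν : Measure ℝ}

lemma pi_real_isolatedNoise [SigmaFinite ν] : (Measure.pi fun _ : ι => ν).real (isolatedNoise j A) =
    ν.real A * ν.real {0} ^ (Fintype.card ι - 1) := by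
  classical
  have hfactor (i : ι) : ν.real (Function.update (fun _ : ι => ({0} : Set ℝ)) j A i) =
      Function.update (fun _ => ν.real {0}) j (ν.real A) i :=
    Function.apply_update (fun _ => ν.real) _ _ _ _
  rw [isolatedNoise_eq_pi, measureReal_def, Measure.pi_pi, ENNReal.toReal_prod]
  simp_rw [← measureReal_def, hfactor]
  rw [Finset.prod_update_of_mem (Finset.mem_univ j), Finset.prod_const,
    Finset.card_sdiff_of_subset (Finset.subset_univ _), Finset.card_singleton, Finset.card_univ]

lemma half_mul_le_pi_real_isolatedNoise [IsProbabilityMeasure ν]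
    (hν : Fintype.card ι * ν.real {0}ᶜ ≤ 1 / 2) :
    ν.real A / 2 ≤ (Measure.pi fun _ : ι => ν).real (isolatedNoise j A) := by
  have hpow : 1 / 2 ≤ ν.real {0} ^ (Fintype.card ι - 1) :=
    calc (1 / 2 : ℝ) ≤ 1 - Fintype.card ι * ν.real {0}ᶜ := by linarith
      _ ≤ 1 - (Fintype.card ι - 1 : ℕ) * ν.real {0}ᶜ := by gcongr; exact Nat.sub_le _ _
      _ ≤ (1 - ν.real {0}ᶜ) ^ (Fintype.card ι - 1) := by
        simpa [sub_eq_add_neg] using one_add_mul_le_pow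
          (show -2 ≤ -ν.real {0}ᶜ by linarith [measureReal_le_one (μ := ν) (s := {0}ᶜ)]) _
      _ = ν.real {0} ^ (Fintype.card ι - 1) := by
        rw [probReal_compl_eq_one_sub (measurableSet_singleton 0), sub_sub_cancel]
  rw [pi_real_isolatedNoise, div_eq_mul_one_div]
  gcongr

end IsolatedNoise

section Risk

variable {M N : ℕ} (tstar : EuclideanSpace ℝ (Fin M))

lemma measurePreserving_modelLaw (ν : Measure ℝ) :
    MeasurePreserving (fun p : EuclideanSpace ℝ (Fin M) × ℝ => (p.1, inner ℝ p.1 tstar + p.2))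
      ((stdGaussian (EuclideanSpace ℝ (Fin M))).prod ν) (modelLaw tstar ν) :=
  ⟨by fun_prop, rfl⟩

instance isProbabilityMeasure_modelLaw (ν : Measure ℝ) [IsProbabilityMeasure ν] :
    IsProbabilityMeasure (modelLaw tstar ν) :=
  Measure.isProbabilityMeasure_map (measurePreserving_modelLaw tstar ν).measurable.aemeasurable

instance isProbabilityMeasure_sampleLaw (ν : Measure ℝ) [IsProbabilityMeasure ν] :
    IsProbabilityMeasure (sampleLaw N tstar ν) := by
  unfold sampleLaw
  infer_instance

variable {ν : Measure ℝ} (t : EuclideanSpace ℝ (Fin M))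

lemma measurable_loss : Measurable (loss t) := by
  unfold loss
  fun_prop

lemma loss_apply_model (p : EuclideanSpace ℝ (Fin M) × ℝ) :
    loss t (p.1, inner ℝ p.1 tstar + p.2) = (inner ℝ p.1 (tstar - t) + p.2) ^ 2 := by
  rw [loss, inner_sub_right, sub_add_eq_add_sub]

lemma integrable_loss [IsProbabilityMeasure ν] (hν : MemLp (fun z => z) 2 ν) :
    Integrable (loss t) (modelLaw tstar ν) := by
  rw [← (measurePreserving_modelLaw tstar ν).integrable_comp
    (measurable_loss t).aestronglyMeasurable]
  simp only [Function.comp_def, loss_apply_model]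
  exact (((memLp_inner_stdGaussian _).comp_fst ν).add (hν.comp_snd _)).integrable_sq

lemma risk_eq (hν : IsStandardizedNoise ν) : risk tstar ν t = ‖t - tstar‖ ^ 2 + 1 := by
  have := hν.isProbabilityMeasure
  have hX := memLp_inner_stdGaussian (tstar - t)
  have hmean : ∫ p, inner ℝ p.1 (tstar - t) + p.2
      ∂(stdGaussian (EuclideanSpace ℝ (Fin M))).prod ν = 0 := by
    rw [integral_add ((hX.integrable one_le_two).comp_fst ν)
      ((hν.memLp_two.integrable one_le_two).comp_snd _), integral_fun_fst fun x => inner ℝ x _,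
      integral_fun_snd fun z : ℝ => z, integral_inner_stdGaussian, hν.mean_eq_zero]
    simp
  rw [risk, ← (measurePreserving_modelLaw tstar ν).hasLaw.integral_comp
    (measurable_loss t).aestronglyMeasurable]
  simp only [Function.comp_def, loss_apply_model]
  rw [← variance_of_integral_eq_zero (by fun_prop) hmean, variance_add_prod hX hν.memLp_two,
    variance_inner_stdGaussian, hν.variance_eq_one, norm_sub_rev]

end Risk

section Spike

variable {M N : ℕ} (tstar : EuclideanSpace ℝ (Fin M))

lemma measurePreserving_design_residual (ν : Measure ℝ) [IsProbabilityMeasure ν] :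
    MeasurePreserving (fun S : Fin N → EuclideanSpace ℝ (Fin M) × ℝ =>
        (fun i => (S i).1, residual tstar S))
      (sampleLaw N tstar ν)
      ((Measure.pi fun _ => stdGaussian (EuclideanSpace ℝ (Fin M))).prod
        (Measure.pi fun _ => ν)) := by
  have hpair : MeasurePreserving (fun p : EuclideanSpace ℝ (Fin M) × ℝ =>
      (p.1, p.2 - inner ℝ p.1 tstar)) (modelLaw tstar ν)
      ((stdGaussian (EuclideanSpace ℝ (Fin M))).prod ν) := by
    refine ⟨by fun_prop, ?_⟩
    rw [modelLaw, Measure.map_map (by fun_prop) (by fun_prop)]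
    simp [Function.comp_def]
  exact (measurePreserving_arrowProdEquivProdArrow _ _ (Fin N) _ _).comp
    (measurePreserving_pi _ _ fun _ => hpair)

/-- The samples whose noise variables `ζ_i` all vanish but one, which satisfies `a ≤ ζ_j ^ 2` and
occurs at a typical vector `X_j` of the design. -/
def spikedSamples (a : ℝ) : Set (Fin N → EuclideanSpace ℝ (Fin M) × ℝ) :=
  (fun S => (fun i => (S i).1, residual tstar S)) ⁻¹'
    ⋃ j, typicalDesign (EuclideanSpace ℝ (Fin M)) j ×ˢ isolatedNoise j {z | a ≤ z ^ 2}

lemma measurableSet_typicalDesign_prod_isolatedNoise (j : Fin N) (a : ℝ) :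
    MeasurableSet (typicalDesign (EuclideanSpace ℝ (Fin M)) j ×ˢ
      isolatedNoise j {z | a ≤ z ^ 2}) :=
  (measurableSet_typicalDesign j).prod
    (measurableSet_isolatedNoise (measurableSet_le (by fun_prop) (by fun_prop)))

lemma measurableSet_spikedSamples (a : ℝ) : MeasurableSet (spikedSamples (N := N) tstar a) :=
  measurableSet_preimage (by unfold residual; fun_prop)
    (MeasurableSet.iUnion fun j => measurableSet_typicalDesign_prod_isolatedNoise j a)

lemma mul_div_four_le_sampleLaw_real_spikedSamples [NeZero M] {ν : Measure ℝ}
    [IsProbabilityMeasure ν] (hν : N * ν.real {0}ᶜ ≤ 1 / 2) {a : ℝ} (ha : 0 < a) :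
    N * ν.real {z | a ≤ z ^ 2} / 4 ≤ (sampleLaw N tstar ν).real (spikedSamples tstar a) := by
  have hmeas (j : Fin N) := measurableSet_typicalDesign_prod_isolatedNoise (M := M) j a
  have hdisj : Pairwise (Function.onFun Disjoint fun j : Fin N =>
      typicalDesign (EuclideanSpace ℝ (Fin M)) j ×ˢ isolatedNoise j {z | a ≤ z ^ 2}) :=
    fun j k hjk => Set.Disjoint.set_prod_right (disjoint_isolatedNoise (by simpa using ha) hjk) _ _
  rw [spikedSamples, (measurePreserving_design_residual tstar ν).measureReal_preimage
    (MeasurableSet.iUnion hmeas).nullMeasurableSet, measureReal_iUnion_fintype hdisj hmeas]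
  simp_rw [measureReal_prod_prod]
  calc N * ν.real {z | a ≤ z ^ 2} / 4 = ∑ _j : Fin N, 1 / 2 * (ν.real {z | a ≤ z ^ 2} / 2) := by
        rw [Finset.sum_const, Finset.card_fin, nsmul_eq_mul]
        ring
    _ ≤ _ := by
        gcongr with j
        · exact half_le_stdGaussian_pi_real_typicalDesign j
        · exact half_mul_le_pi_real_isolatedNoise (by simpa using hν)

lemma mul_div_le_norm_sub_sq_of_mem_spikedSamples (hMN : M ≤ N) {a : ℝ}
    {S : Fin N → EuclideanSpace ℝ (Fin M) × ℝ} (hS : S ∈ spikedSamples tstar a)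
    {t : EuclideanSpace ℝ (Fin M)} (ht : t ∈ ermSet S) :
    a * (M / (128 ^ 3 * 72 ^ 2 * N ^ 2)) ≤ ‖t - tstar‖ ^ 2 := by
  obtain ⟨j, hdesign, hlarge, hzero⟩ := Set.mem_iUnion.1 hS
  have herror := sq_mul_finrank_div_le_of_isMinOn hdesign (by simpa using hMN) hzero
    ((mem_ermSet_iff_isMinOn tstar).1 ht)
  rw [finrank_euclideanSpace_fin, Fintype.card_fin] at herror
  exact (mul_le_mul_of_nonneg_right hlarge (by positivity)).trans herror

end Spike

section HeavyTailedError

/-- The noise equals `±√(2 * x * (N + 1))` with probability `1 / (2 * x * (N + 1))`: a sample then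
contains a single spike with probability of order `1 / x`, and `N + 1` instead of `N` keeps the law
standardized for `N = 0`. -/
lemma exists_isStandardizedNoise_forall_norm_sub_sq_ge :
    ∃ c₁ c₂ : ℝ, 0 < c₁ ∧ 0 < c₂ ∧ ∀ (M N : ℕ) (x : ℝ), 1 ≤ x → M ≤ N →
      ∃ ν, IsStandardizedNoise ν ∧ ∀ tstar : EuclideanSpace ℝ (Fin M), ∃ G, MeasurableSet G ∧
        c₁ / x ≤ (sampleLaw N tstar ν).real G ∧
        ∀ S ∈ G, ∀ t ∈ ermSet S, c₂ * x * M / N ≤ ‖t - tstar‖ ^ 2 := by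
  refine ⟨1 / 16, 2 / (128 ^ 3 * 72 ^ 2), by norm_num, by norm_num, fun M N x hx hMN => ?_⟩
  set p : ℝ := (2 * x * (N + 1))⁻¹
  have hp₀ : 0 < p := by positivity
  have hNp : N * p ≤ 1 / 2 := by
    rw [← div_eq_mul_inv, div_le_iff₀ (by positivity)]
    nlinarith
  have hp₁ : p ≤ 1 := inv_le_one_of_one_le₀ (by nlinarith [Nat.cast_nonneg (α := ℝ) N])
  have hν := isStandardizedNoise_sparseNoise hp₀ hp₁
  have := hν.isProbabilityMeasure
  refine ⟨sparseNoise p, hν, fun tstar => ?_⟩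
  rcases M.eq_zero_or_pos with rfl | hM
  · refine ⟨Set.univ, MeasurableSet.univ, ?_, fun S _ t _ => by simp⟩
    rw [probReal_univ, div_le_one (by positivity)]
    linarith
  have hN : (1 : ℝ) ≤ N := Nat.one_le_cast.2 (hM.trans_le hMN)
  have : NeZero M := ⟨hM.ne'⟩
  refine ⟨spikedSamples tstar p⁻¹, measurableSet_spikedSamples tstar p⁻¹, ?_, fun S hS t ht => ?_⟩
  · calc 1 / 16 / x ≤ N * p / 4 := by
          rw [← div_eq_mul_inv, div_div, div_div, div_le_div_iff₀ (by positivity) (by positivity)]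
          nlinarith
      _ = N * (sparseNoise p).real {z | p⁻¹ ≤ z ^ 2} / 4 := by
          rw [sparseNoise_real_inv_le_sq hp₀ hp₁]
      _ ≤ _ := mul_div_four_le_sampleLaw_real_spikedSamples tstar
          (by rwa [sparseNoise_real_compl_zero hp₀ hp₁]) (inv_pos.2 hp₀)
  · calc 2 / (128 ^ 3 * 72 ^ 2) * x * M / N
        = 2 * x * N * (M / (128 ^ 3 * 72 ^ 2 * N ^ 2)) := by field_simp
      _ ≤ p⁻¹ * (M / (128 ^ 3 * 72 ^ 2 * N ^ 2)) := by
          rw [inv_inv]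
          gcongr
          exact le_add_of_nonneg_right zero_le_one
      _ ≤ ‖t - tstar‖ ^ 2 := mul_div_le_norm_sub_sq_of_mem_spikedSamples tstar hMN hS ht

lemma exists_pos_forall_eventually_sampleLaw_real_le (C : ℝ) : ∃ c : ℝ, 0 < c ∧
    ∀ (M : ℕ), 1 ≤ M → ∀ (tstar : EuclideanSpace ℝ (Fin M)) (x : ℝ), 1 ≤ x →
      ∀ᶠ N : ℕ in atTop, ∃ ν, IsStandardizedNoise ν ∧ (sampleLaw N tstar ν).real
        {S | ∃ t ∈ ermSet S, ‖t - tstar‖ ^ 2 ≤ C * x * M / N} ≤ 1 - c / x := by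
  obtain ⟨c₁, c₂, hc₁, hc₂, hspiked⟩ := exists_isStandardizedNoise_forall_norm_sub_sq_ge
  set D : ℝ := |C| / c₂ + 1
  have hD : 1 ≤ D := le_add_of_nonneg_left (by positivity)
  have hCD : C < c₂ * D := by
    have : c₂ * D = |C| + c₂ := by simp only [D]; field_simp
    linarith [le_abs_self C]
  refine ⟨c₁ / D, by positivity, fun M hM tstar x hx => ?_⟩
  filter_upwards [eventually_ge_atTop M] with N hMN
  obtain ⟨ν, hν, hG⟩ := hspiked M N (D * x) (one_le_mul_of_one_le_of_one_le hD hx) hMN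
  obtain ⟨G, hGmeas, hGprob, hGerr⟩ := hG tstar
  have := hν.isProbabilityMeasure
  have : (0 : ℝ) < M := Nat.cast_pos.2 hM
  have hN₀ : (0 : ℝ) < N := Nat.cast_pos.2 (hM.trans hMN)
  have hscale : C * x * M / N < c₂ * (D * x) * M / N := by
    rw [← mul_assoc c₂]
    gcongr
  have hcompl : {S | ∃ t ∈ ermSet S, ‖t - tstar‖ ^ 2 ≤ C * x * M / N} ⊆ Gᶜ :=
    fun S ⟨t, ht, hle⟩ hS => (hscale.trans_le (hGerr S hS t ht)).not_ge hle
  refine ⟨ν, hν, (measureReal_mono hcompl).trans ?_⟩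
  rw [probReal_compl_eq_one_sub hGmeas, div_div]
  linarith

lemma not_forall_eventually_le_sampleLaw_real {M : ℕ} (hM : 1 ≤ M)
    (tstar : EuclideanSpace ℝ (Fin M)) (C : ℝ) {δ : ℝ → ℝ} (hδ : δ =o[atTop] fun x => x⁻¹)
    {ε : ℕ → ℝ} (hε : Tendsto ε atTop (𝓝 0)) :
    ¬ ∀ x : ℝ, 1 ≤ x → ∀ᶠ N : ℕ in atTop, ∀ ν, IsStandardizedNoise ν →
      1 - ε N - δ x ≤ (sampleLaw N tstar ν).real
        {S | ∃ t ∈ ermSet S, ‖t - tstar‖ ^ 2 ≤ C * x * M / N} := by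
  intro hbound
  obtain ⟨c, hc, hsparse⟩ := exists_pos_forall_eventually_sampleLaw_real_le C
  have hrate : ∀ x : ℝ, 1 ≤ x → c / x ≤ δ x := by
    intro x hx
    have hlim : Tendsto (fun N => ε N + δ x) atTop (𝓝 (δ x)) := by simpa using hε.add_const (δ x)
    refine ge_of_tendsto hlim ?_
    filter_upwards [hbound x hx, hsparse M hM tstar x hx] with N hN ⟨ν, hν, hle⟩
    linarith [hN ν hν]
  obtain ⟨x, hx, hsmall⟩ := ((eventually_ge_atTop 1).and (hδ.bound (half_pos hc))).exists
  have hx₀ : 0 < x := zero_lt_one.trans_le hx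
  rw [norm_inv, Real.norm_of_nonneg hx₀.le, ← div_eq_mul_inv] at hsmall
  have hhalf : c / x ≤ c / 2 / x := (hrate x hx).trans ((Real.le_norm_self _).trans hsmall)
  rw [div_le_div_iff_of_pos_right hx₀] at hhalf
  linarith

end HeavyTailedError

end GaussianLinearModel

open GaussianLinearModel in
theorem mainTheorem4_general :
    (∃ c₁ c₂ : ℝ, 0 < c₁ ∧ 0 < c₂ ∧ ∀ (M N : ℕ) (x : ℝ), 1 ≤ x → M ≤ N →
      ∃ ν, IsStandardizedNoise ν ∧ ∀ tstar : EuclideanSpace ℝ (Fin M),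
        (∀ t, Integrable (loss t) (modelLaw tstar ν) ∧
          ‖t - tstar‖ ^ 2 = risk tstar ν t - risk tstar ν tstar) ∧
        c₁ / x ≤ (sampleLaw N tstar ν).real {S | (ermSet S).Nonempty ∧
          ∀ t ∈ ermSet S, c₂ * x * M / N ≤ ‖t - tstar‖ ^ 2}) ∧
    ∀ (M : ℕ), 1 ≤ M → ∀ (tstar : EuclideanSpace ℝ (Fin M)) (C : ℝ) (δ : ℝ → ℝ) (ε : ℕ → ℝ),
      δ =o[atTop] (fun x => x⁻¹) → Tendsto ε atTop (𝓝 0) →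
        ¬ ∀ x : ℝ, 1 ≤ x → ∀ᶠ N : ℕ in atTop, ∀ ν, IsStandardizedNoise ν →
          1 - ε N - δ x ≤ (sampleLaw N tstar ν).real
            {S | ∃ t ∈ ermSet S, ‖t - tstar‖ ^ 2 ≤ C * x * M / N} := by
  obtain ⟨c₁, c₂, hc₁, hc₂, hspiked⟩ := exists_isStandardizedNoise_forall_norm_sub_sq_ge
  refine ⟨⟨c₁, c₂, hc₁, hc₂, fun M N x hx hMN => ?_⟩, fun M hM tstar C δ ε hδ hε =>
    not_forall_eventually_le_sampleLaw_real hM tstar C hδ hε⟩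
  obtain ⟨ν, hν, hG⟩ := hspiked M N x hx hMN
  have := hν.isProbabilityMeasure
  refine ⟨ν, hν, fun tstar => ⟨fun t => ⟨integrable_loss tstar t hν.memLp_two, ?_⟩, ?_⟩⟩
  · simp [risk_eq _ _ hν]
  · obtain ⟨G, -, hGprob, hGerr⟩ := hG tstar
    exact hGprob.trans (measureReal_mono fun S hS => ⟨ermSet_nonempty S, hGerr S hS⟩)

theorem mainTheorem4 :
    (∃ c₀ c₁ c₂ : ℝ, 0 < c₀ ∧ 0 < c₁ ∧ 0 < c₂ ∧
      ∀ (M N : ℕ) (x : ℝ), 1 ≤ x → c₀ * (M : ℝ) ≤ (N : ℝ) →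
        ∃ ν : Measure ℝ, GaussianLinearModel.IsStandardizedNoise ν ∧
          ∀ tstar : EuclideanSpace ℝ (Fin M),
            (∀ t : EuclideanSpace ℝ (Fin M),
              Integrable (GaussianLinearModel.loss t) (GaussianLinearModel.modelLaw tstar ν) ∧
              ‖t - tstar‖ ^ 2 = GaussianLinearModel.risk tstar ν t
                - GaussianLinearModel.risk tstar ν tstar) ∧
            c₁ / x ≤ (GaussianLinearModel.sampleLaw N tstar ν).real
              {S | (GaussianLinearModel.ermSet S).Nonempty ∧
                ∀ t ∈ GaussianLinearModel.ermSet S,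
                  c₂ * x * (M : ℝ) / (N : ℝ) ≤ ‖t - tstar‖ ^ 2}) ∧
    (∀ (M : ℕ), 1 ≤ M → ∀ (tstar : EuclideanSpace ℝ (Fin M)) (C K b : ℝ) (ε : ℕ → ℝ),
      0 < C → 0 < K → 0 < b → Tendsto ε atTop (𝓝 0) →
        ¬ ∀ x : ℝ, 1 ≤ x → ∀ᶠ N : ℕ in atTop,
          ∀ ν : Measure ℝ, GaussianLinearModel.IsStandardizedNoise ν →
            1 - ε N - K * Real.exp (-(b * x)) ≤
              (GaussianLinearModel.sampleLaw N tstar ν).real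
                {S | ∃ t ∈ GaussianLinearModel.ermSet S,
                  ‖t - tstar‖ ^ 2 ≤ C * x * (M : ℝ) / (N : ℝ)}) := by
  obtain ⟨⟨c₁, c₂, hc₁, hc₂, hlower⟩, hrate⟩ := mainTheorem4_general
  refine ⟨⟨1, c₁, c₂, one_pos, hc₁, hc₂, fun M N x hx hMN =>
    hlower M N x hx (by rwa [one_mul, Nat.cast_le] at hMN)⟩, fun M hM tstar C K b ε _ _ hb hε =>
    hrate M hM tstar C _ ε (Asymptotics.IsLittleO.const_mul_left ?_ K) hε⟩
  simpa [Real.rpow_neg_one] using isLittleO_exp_neg_mul_rpow_atTop hb (-1)
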